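/- A hypergraph on $[n]=\{1,\dots,n\}$ is a pair $H=([n],E)$, where $E$ is a finite multiset of subsets of $[n]$, each with at least two elements (the elements of $E$, counted with multiplicity, are the edges; copies of a repeated edge are distinct edges). A walk is a sequence $v_0,e_1,v_1,\dots,e_m,v_m$ ($m\ge 0$) of vertices $v_i$ and edges $e_i$ with $\{v_{i-1},v_i\}\subseteq e_i$ for $1\le i\le m$. It is a path if all $v_i$ are distinct and all $e_i$ are distinct, and a cycle if $m\ge 2$, all $e_i$ are distinct, and all $v_i$ are distinct except that $v_0=v_m$. A hypertree is a hypergraph without cycles in which any two vertices are joined by a path. A rooted hypertree on $[n]$ is a hypertree on $[n]$ (with labeled vertices and unlabeled edges) together with a choice of one of its vertices as root. Let $n\ge 1$. Then for every integer $k\ge 0$ the number of rooted hypertrees on $[n]$ with exactly $k$ edges is $n^k S(n-1,k)$, where $S(\cdot,\cdot)$ denotes the Stirling numbers of the second kind (with $S(0,0)=1$). In particular, the total number of rooted hypertrees on $[n]$ is finite and equal to $\sum_{k=0}^{n-1} n^k S(n-1,k)$. -/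

import Mathlib

/-- A hypergraph (without loops, repeated edges allowed) with vertex set `V`: a finite multiset of
finite subsets of `V`, each of which has at least two elements. -/
structure MultiHypergraph (V : Type*) where
  /-- The multiset of edges. -/
  edges : Multiset (Finset V)
  /-- Every edge contains at least two vertices. -/
  two_le_card : ∀ e ∈ edges, 2 ≤ e.card

namespace MultiHypergraph

/-- The edges of `H`, where the copies of a repeated edge count as distinct edges. The set of
vertices of `e : H.Edge` is `e.1`. -/
abbrev Edge {V : Type*} [DecidableEq V] (H : MultiHypergraph V) : Type _ := H.edges.ToType

/-- A walk `v 0, e 0, v 1, e 1, …, e (m - 1), v m` with `m` edges: both `v i` and `v (i + 1)`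
belong to `e i`. -/
structure Walk {V : Type*} [DecidableEq V] (H : MultiHypergraph V) where
  /-- The number of edges of the walk. -/
  length : ℕ
  /-- The vertices of the walk. -/
  vert : Fin (length + 1) → V
  /-- The edges of the walk. -/
  edge : Fin length → H.Edge
  /-- Each edge contains the vertex before it. -/
  left_mem : ∀ i : Fin length, vert i.castSucc ∈ (edge i).1
  /-- Each edge contains the vertex after it. -/
  right_mem : ∀ i : Fin length, vert i.succ ∈ (edge i).1

/-- A path is a walk whose vertices are all distinct and whose edges are all distinct. -/
def Walk.IsPath {V : Type*} [DecidableEq V] {H : MultiHypergraph V} (w : H.Walk) : Prop :=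
  Function.Injective w.vert ∧ Function.Injective w.edge

/-- A cycle is a walk with at least two edges, whose edges are all distinct, and whose vertices are
all distinct except that the last one equals the first one. -/
def Walk.IsCycle {V : Type*} [DecidableEq V] {H : MultiHypergraph V} (w : H.Walk) : Prop :=
  2 ≤ w.length ∧ Function.Injective w.edge ∧ w.vert 0 = w.vert (Fin.last w.length) ∧
    Function.Injective fun i : Fin w.length => w.vert i.castSucc

/-- A hypergraph is connected if any two vertices are joined by a path. -/
def Connected {V : Type*} [DecidableEq V] (H : MultiHypergraph V) : Prop :=
  ∀ x y : V, ∃ w : H.Walk, w.IsPath ∧ w.vert 0 = x ∧ w.vert (Fin.last w.length) = y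

/-- A hypertree is a connected hypergraph without cycles. -/
def IsHypertree {V : Type*} [DecidableEq V] (H : MultiHypergraph V) : Prop :=
  H.Connected ∧ ∀ w : H.Walk, ¬ w.IsCycle

end MultiHypergraph

/-- The rooted hypertrees with vertex set `V`: pairs of a hypertree with vertex set `V` and one of
its vertices, the root. -/
def rootedHypertrees (V : Type*) [DecidableEq V] : Set (MultiHypergraph V × V) :=
  {p | p.1.IsHypertree}

/-!
Fix a root `r` of a hypertree. Each edge has exactly one vertex from which `r` can be reached
without using this edge, its parent, and every vertex other than `r` is a non-parent vertex of
exactly one edge. A hypertree with edges labelled by `Fin k` is therefore the same as a surjection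
`f` from the vertices other than `r` onto the labels, together with a choice of parents that is
acyclic: following a label `i` to the label of the parent of `i` always ends at `r`.

There are `k! S(n-1, k)` surjections. The number `a` of acyclic parent functions satisfies
`a n = u n ^ k` for any labelling of `n` vertices by `k` labels that leaves `u` vertices unlabelled:
choosing the parent of one label and merging its vertices with those of its parent's label (or with
the unlabelled vertices) reduces `k` by one. Here `u = 1`, so that the `n` choices of the root give
`n ^ k k! S(n-1, k)` rooted hypertrees with labelled edges. The edges of a hypertree are distinct,
since two copies of an edge form a cycle, hence forgetting the labels divides the number by `k!`.
-/

section Counting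

theorem insert_eq_iff_eq_or_eq_diff_singleton {α : Type*} {a : α} {s t : Set α} (ha : a ∈ t) :
    insert a s = t ↔ s = t ∨ s = t \ {a} := by
  grind

/-- Functions with range `t`, split according to their first value. -/
def rangeEqSuccEquiv {α : Type*} (m : ℕ) (t : Set α) :
    {g : Fin (m + 1) → α // Set.range g = t} ≃
      Σ a : t, {g : Fin m → α // Set.range g = t ∨ Set.range g = t \ {a.1}} where
  toFun g := ⟨⟨g.1 0, g.2.subset (Set.mem_range_self 0)⟩, Fin.tail g.1,
    (insert_eq_iff_eq_or_eq_diff_singleton (g.2.subset (Set.mem_range_self 0))).1 <| by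
      rw [← Fin.range_cons, Fin.cons_self_tail, g.2]⟩
  invFun g := ⟨Fin.cons g.1.1 g.2.1, by
    rw [Fin.range_cons, insert_eq_iff_eq_or_eq_diff_singleton g.1.2]
    exact g.2.2⟩
  left_inv g := Subtype.ext (Fin.cons_self_tail g.1)
  right_inv _ := rfl

theorem card_range_eq {α : Type*} [Finite α] (m : ℕ) (t : Set α) :
    Nat.card {g : Fin m → α // Set.range g = t} =
      t.ncard.factorial * m.stirlingSecond t.ncard := by
  induction m generalizing t with
  | zero =>
    rcases t.eq_empty_or_nonempty with rfl | ht
    · simp [Set.range_eq_empty]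
    · obtain ⟨k, hk⟩ := Nat.exists_eq_succ_of_ne_zero ht.ncard_pos.ne'
      simp [Set.range_eq_empty, ht.ne_empty.symm, hk]
  | succ m ih =>
    classical
    have : Fintype t := Fintype.ofFinite t
    have hsplit (a : t) :
        Nat.card {g : Fin m → α // Set.range g = t ∨ Set.range g = t \ {a.1}} =
          t.ncard.factorial * m.stirlingSecond t.ncard +
            (t.ncard - 1).factorial * m.stirlingSecond (t.ncard - 1) := by
      have hne : t ≠ t \ {a.1} := fun h => (h ▸ a.2 : a.1 ∈ t \ {a.1}).2 rfl
      rw [Nat.card_congr (subtypeOrEquiv _ _ ?_), Nat.card_sum, ih, ih,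
        Set.ncard_sdiff_singleton_of_mem a.2]
      exact Pi.disjoint_iff.2 fun g => Prop.disjoint_iff.2 fun h => hne (h.1.symm.trans h.2)
    rw [Nat.card_congr (rangeEqSuccEquiv m t), Nat.card_sigma, Fintype.sum_congr _ _ hsplit,
      Finset.sum_const, Finset.card_univ, ← Nat.card_eq_fintype_card, Nat.card_coe_set_eq,
      smul_eq_mul]
    rcases t.ncard with _ | k
    · simp
    · rw [Nat.add_sub_cancel, Nat.stirlingSecond_succ_succ, Nat.factorial_succ]
      ring

theorem card_surjective (α β : Type*) [Finite α] [Finite β] :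
    Nat.card {g : α → β // Function.Surjective g} =
      (Nat.card β).factorial * (Nat.card α).stirlingSecond (Nat.card β) := by
  rw [← Set.ncard_univ β, ← card_range_eq]
  refine Nat.card_congr (((Finite.equivFin α).arrowCongr (Equiv.refl β)).subtypeEquiv fun g => ?_)
  rw [Set.range_eq_univ]
  exact ((Finite.equivFin α).symm.surjective_comp g).symm

theorem exists_equiv_toType_of_map_univ_eq {ι α : Type*} [Fintype ι] [DecidableEq α]
    {e : ι → α} {m : Multiset α} (h : Finset.univ.val.map e = m) :
    ∃ φ : ι ≃ m.ToType, ∀ i, (φ i).1 = e i := by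
  classical
  subst h
  have hbij : Function.Bijective fun x : (Finset.univ : Finset ι).val.ToType => x.1 := by
    rw [Fintype.bijective_iff_surjective_and_card]
    exact ⟨fun i => ⟨⟨i, 0, Multiset.count_pos.2 (Finset.mem_univ_val i)⟩, rfl⟩,
      by simp⟩
  refine ⟨(Equiv.ofBijective _ hbij).symm.trans (Multiset.mapEquiv _ e), fun i => ?_⟩
  rw [Equiv.trans_apply, Multiset.mapEquiv_apply]
  exact congrArg e ((Equiv.ofBijective _ hbij).apply_symm_apply i)

theorem exists_map_univ_eq {ι α : Type*} [Fintype ι] {m : Multiset α}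
    (hm : m.card = Fintype.card ι) : ∃ e : ι → α, Finset.univ.val.map e = m := by
  classical
  have φ : ι ≃ m.ToType := Fintype.equivOfCardEq (by rw [Multiset.card_coe, hm])
  refine ⟨fun i => (φ i).1, ?_⟩
  calc Finset.univ.val.map (fun i => (φ i).1)
      = (Finset.univ.val.map φ).map (fun x => x.1) := (Multiset.map_map _ _ _).symm
    _ = m := by rw [Multiset.map_univ_val_equiv, Multiset.map_univ_coe]

theorem map_univ_eq_map_univ_iff {ι α : Type*} [Fintype ι] {e e' : ι → α} :
    Finset.univ.val.map e' = Finset.univ.val.map e ↔ ∃ σ : Equiv.Perm ι, e ∘ σ = e' := by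
  classical
  constructor
  · intro h
    obtain ⟨φ, hφ⟩ := exists_equiv_toType_of_map_univ_eq (e := e) rfl
    obtain ⟨ψ, hψ⟩ := exists_equiv_toType_of_map_univ_eq h
    refine ⟨ψ.trans φ.symm, funext fun i => ?_⟩
    simp [← hφ, hψ]
  · rintro ⟨σ, rfl⟩
    rw [← Multiset.map_map, Multiset.map_univ_val_equiv]

theorem encard_setOf_map_univ_mem {α : Type*} (ι : Type*) [Fintype ι] {T : Set (Multiset α)}
    (hnodup : ∀ m ∈ T, m.Nodup) (hcard : ∀ m ∈ T, m.card = Fintype.card ι) :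
    {e : ι → α | Finset.univ.val.map e ∈ T}.encard =
      ((Fintype.card ι).factorial : ℕ∞) * T.encard := by
  classical
  choose enum henum using fun m : T => exists_map_univ_eq (hcard m.1 m.2)
  have henum_inj (m : T) : Function.Injective (enum m) := fun i j =>
    Multiset.inj_on_of_nodup_map (henum m ▸ hnodup m.1 m.2) i (Finset.mem_univ_val i) j
      (Finset.mem_univ_val j)
  have hmap (x : Equiv.Perm ι × T) : Finset.univ.val.map (enum x.2 ∘ x.1) = x.2.1 :=
    (map_univ_eq_map_univ_iff.2 ⟨x.1, rfl⟩).trans (henum x.2)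
  let relabel (x : Equiv.Perm ι × T) : {e : ι → α | Finset.univ.val.map e ∈ T} :=
    ⟨enum x.2 ∘ x.1, Set.mem_ofPred.2 (hmap x ▸ x.2.2)⟩
  have hbij : Function.Bijective relabel := by
    constructor
    · rintro ⟨σ, m⟩ ⟨τ, m'⟩ h
      have h' : enum m ∘ σ = enum m' ∘ τ := congrArg Subtype.val h
      obtain rfl : m = m' := Subtype.ext <| by rw [← hmap (σ, m), h', hmap (τ, m')]
      rw [Equiv.ext fun i => henum_inj m (congrFun h' i)]
    · rintro ⟨e, he⟩
      obtain ⟨σ, hσ⟩ := map_univ_eq_map_univ_iff.1 (henum ⟨_, he⟩).symm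
      exact ⟨(σ, ⟨_, he⟩), Subtype.ext hσ⟩
  rw [Set.encard, ← ENat.card_congr (Equiv.ofBijective relabel hbij), ENat.card_prod,
    ENat.card_eq_coe_fintype_card, Fintype.card_perm, Set.encard]

theorem encard_eq_sum_encard_fiber {α κ : Type*} {s : Set α} {t : Finset κ} {g : α → κ}
    (h : ∀ a ∈ s, g a ∈ t) : s.encard = ∑ k ∈ t, {a ∈ s | g a = k}.encard := by
  have hs : s = ⋃ k ∈ (t : Set κ), {a ∈ s | g a = k} := by
    ext a
    simpa using h a
  conv_lhs => rw [hs, t.finite_toSet.encard_biUnion fun k _ l _ hkl =>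
    Set.disjoint_left.2 fun a ha hb => hkl (ha.2.symm.trans hb.2)]
  exact finsum_mem_coe_finset _ t

end Counting

section AcyclicParents

variable {V ι κ : Type*}

/-- A partial labelling `f` of vertices, together with a parent vertex `p i` for each label `i`,
makes the label of `p i` the parent of `i` (and `i` an orphan when `p i` has no label). The parent
function is acyclic if iterating parents always terminates; for finitely many labels this is the
existence of a rank function that decreases along parents. -/
def IsAcyclicParent (f : V → Option ι) (p : ι → V) : Prop :=
  ∃ rank : ι → ℕ, ∀ i j, f (p i) = some j → rank j < rank i

theorem isAcyclicParent_map_comp_equiv_iff {f : V → Option ι} {p : ι → V} (φ : κ ≃ ι) :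
    IsAcyclicParent (fun v => (f v).map φ.symm) (p ∘ φ) ↔ IsAcyclicParent f p := by
  constructor
  · rintro ⟨rank, hrank⟩
    refine ⟨rank ∘ φ.symm, fun i j hij => hrank _ _ ?_⟩
    simp [hij]
  · rintro ⟨rank, hrank⟩
    refine ⟨rank ∘ φ, fun i j hij => hrank _ _ ?_⟩
    simpa [Option.map_eq_some_iff, Equiv.symm_apply_eq] using hij

/-- The labelling obtained from `f` by giving the vertices labelled `none` the label of `v`. If `v`
is the parent of `none`, this removes `none` from the labels and passes its children on to its
parent. -/
def mergeClass (f : V → Option (Option ι)) (v x : V) : Option ι :=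
  (f x).bind fun i => i.elim (f v).join some

theorem mergeClass_eq_some_iff {f : V → Option (Option ι)} {v x : V} {j : ι} :
    mergeClass f v x = some j ↔
      f x = some (some j) ∨ f x = some none ∧ f v = some (some j) := by
  rcases hx : f x with _ | _ | i <;> simp [mergeClass, hx, Option.join_eq_some_iff]

theorem mergeClass_eq_none_iff {f : V → Option (Option ι)} {v x : V} (hv : f v ≠ some none) :
    mergeClass f v x = none ↔ f x = none ∨ f x = some none ∧ f v = none := by
  rcases hx : f x with _ | _ | i <;> simp [mergeClass, hx, Option.join_eq_none_iff, hv]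

theorem IsAcyclicParent.comp_some {f : V → Option (Option ι)} {p : Option ι → V}
    (h : IsAcyclicParent f p) : IsAcyclicParent (mergeClass f (p none)) (p ∘ some) := by
  obtain ⟨rank, hrank⟩ := h
  refine ⟨rank ∘ some, fun i j hij => ?_⟩
  obtain hij | ⟨hi, hj⟩ := mergeClass_eq_some_iff.1 hij
  · exact hrank _ _ hij
  · exact (hrank _ _ hj).trans (hrank _ _ hi)

theorem IsAcyclicParent.of_comp_some {f : V → Option (Option ι)} {p : Option ι → V}
    (hnone : f (p none) ≠ some none)
    (h : IsAcyclicParent (mergeClass f (p none)) (p ∘ some)) :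
    IsAcyclicParent f p := by
  obtain ⟨rank, hrank⟩ := h
  -- Doubling the ranks makes room for `none` directly above its parent.
  refine ⟨fun o => o.elim ((f (p none)).join.elim 0 fun i => 2 * rank i + 2)
    fun i => 2 * rank i + 1, ?_⟩
  rintro (_ | i) (_ | j) hij
  · exact (hnone hij).elim
  · simp [hij]
  · rcases hj : (f (p none)).join with _ | j
    · simp
    · have := hrank i j (mergeClass_eq_some_iff.2 (.inr ⟨hij, Option.join_eq_some_iff.1 hj⟩))
      simp only [Option.elim]
      lia
  · have := hrank i j (mergeClass_eq_some_iff.2 (.inl hij))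
    simp only [Option.elim]
    lia

/-- Acyclic parent functions, split according to the parent of `none`. -/
def acyclicParentOptionEquiv (f : V → Option (Option ι)) :
    {p : Option ι → V // IsAcyclicParent f p} ≃
      Σ v : {v : V // f v ≠ some none}, {q : ι → V // IsAcyclicParent (mergeClass f v) q} where
  toFun p := ⟨⟨p.1 none, fun h => p.2.elim fun _ hrank => (hrank _ _ h).false⟩,
    p.1 ∘ some, p.2.comp_some⟩
  invFun q := ⟨fun o => o.elim q.1.1 q.2.1, .of_comp_some q.1.2 q.2.2⟩
  left_inv p := by ext (_ | i) <;> rfl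
  right_inv _ := rfl

theorem card_sigma_mergeClass_eq_none (f : V → Option (Option ι)) :
    Nat.card (Σ v : {v // f v ≠ some none}, {x // mergeClass f v x = none}) =
      Nat.card {x // f x = none} * Nat.card V := by
  classical
  let s (q : V × V) : V × V := if f q.1 = some none ∨ f q.2 = some none then q else q.swap
  have hs : Function.Involutive s := fun q => by grind
  -- `s` exchanges the pairs to be counted with the pairs `(x, v)` such that `f x = none`.
  have hs_iff (q : V × V) :
      (f q.1 ≠ some none ∧ mergeClass f q.1 q.2 = none) ↔ f (s q).1 = none := by
    by_cases h₁ : f q.1 = some none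
    · simp [s, h₁]
    by_cases h₂ : f q.2 = some none <;> simp [s, h₁, h₂, mergeClass_eq_none_iff h₁]
  calc Nat.card (Σ v : {v // f v ≠ some none}, {x // mergeClass f v x = none})
      = Nat.card {q : V × V // f q.1 ≠ some none ∧ mergeClass f q.1 q.2 = none} :=
        Nat.card_congr ⟨fun y => ⟨(y.1, y.2), y.1.2, y.2.2⟩,
          fun q => ⟨⟨q.1.1, q.2.1⟩, ⟨q.1.2, q.2.2⟩⟩, fun _ => rfl, fun _ => rfl⟩
    _ = Nat.card {q : V × V // f q.1 = none} :=
        Nat.card_congr ((hs.toPerm s).subtypeEquiv hs_iff)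
    _ = Nat.card {x // f x = none} * Nat.card V := by
        rw [← Nat.card_prod,
          Nat.card_congr (Equiv.prodSubtypeFstEquivSubtypeProd (p := fun x => f x = none))]

-- When every label belongs to one vertex and one vertex is unlabelled, this is Cayley's formula.
theorem card_isAcyclicParent_mul_card [Finite V] [Finite ι] (f : V → Option ι) :
    Nat.card {p : ι → V // IsAcyclicParent f p} * Nat.card V =
      Nat.card {x // f x = none} * Nat.card V ^ Nat.card ι := by
  induction ι using Finite.induction_empty_option with
  | of_equiv φ ih =>
    have hcard : Nat.card {p // IsAcyclicParent (fun v => (f v).map φ.symm) p} =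
        Nat.card {p // IsAcyclicParent f p} :=
      (Nat.card_congr ((φ.arrowCongr (Equiv.refl V)).symm.subtypeEquiv fun p =>
        (isAcyclicParent_map_comp_equiv_iff φ).symm)).symm
    rw [← hcard, ih, Nat.card_congr φ]
    simp
  | h_empty =>
    have hf (v : V) : f v = none := Subsingleton.elim _ _
    have hacyclic (p : PEmpty → V) : IsAcyclicParent f p := ⟨fun _ => 0, fun i => i.elim⟩
    simp [hf, hacyclic]
  | h_option ih =>
    classical
    have : Fintype V := Fintype.ofFinite V
    rw [Nat.card_congr (acyclicParentOptionEquiv f), Nat.card_sigma]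
    simp only [Finset.sum_mul, ih]
    rw [← Finset.sum_mul, ← Nat.card_sigma, card_sigma_mergeClass_eq_none, Finite.card_option]
    ring

end AcyclicParents

section PrimalGraph

variable {V ι κ : Type*} {e : ι → Finset V} {S T : Set ι} {v w x y : V}

/-- The primal graph of the edges `e j` with `j ∈ S`: two distinct vertices are adjacent if some of
these edges contains both. Its reachability relation is connectedness through edges from `S`. -/
def primalGraph (e : ι → Finset V) (S : Set ι) : SimpleGraph V where
  Adj x y := x ≠ y ∧ ∃ j ∈ S, x ∈ e j ∧ y ∈ e j
  symm := ⟨fun _ _ ⟨hne, j, hj, hx, hy⟩ => ⟨hne.symm, j, hj, hy, hx⟩⟩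
  loopless := ⟨fun _ h => h.1 rfl⟩

theorem reachable_primalGraph_of_mem {j : ι} (hj : j ∈ S) (hx : x ∈ e j) (hy : y ∈ e j) :
    (primalGraph e S).Reachable x y := by
  by_cases hxy : x = y
  · rw [hxy]
  · exact SimpleGraph.Adj.reachable ⟨hxy, j, hj, hx, hy⟩

theorem primalGraph_mono (h : S ⊆ T) : primalGraph e S ≤ primalGraph e T :=
  fun _ _ ⟨hne, j, hj, hxy⟩ => ⟨hne, j, h hj, hxy⟩

theorem primalGraph_comp_equiv (e : ι → Finset V) (φ : κ ≃ ι) (S : Set κ) :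
    primalGraph (e ∘ φ) S = primalGraph e (φ '' S) := by
  ext x y
  simp only [primalGraph, Function.comp_apply, Set.exists_mem_image]

theorem reachable_sdiff_or_exists_mem (h : (primalGraph e S).Reachable x y) (T : Set ι) :
    (primalGraph e (S \ T)).Reachable x y ∨
      ∃ j ∈ T, ∃ z ∈ e j, (primalGraph e (S \ T)).Reachable z y := by
  obtain ⟨p⟩ := h
  induction p with
  | nil => exact .inl .rfl
  | cons hadj _ ih =>
    obtain ⟨-, j, hjS, hxj, hyj⟩ := hadj
    obtain hreach | hexists := ih
    · by_cases hjT : j ∈ T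
      · exact .inr ⟨j, hjT, _, hyj, hreach⟩
      · exact .inl ((reachable_primalGraph_of_mem (S := S \ T) ⟨hjS, hjT⟩ hxj hyj).trans hreach)
    · exact .inr hexists

theorem eq_of_reachable_of_forall_notMem (hv : ∀ j ∈ S, v ∉ e j)
    (h : (primalGraph e S).Reachable v w) : v = w := by
  obtain ⟨p⟩ := h
  cases p with
  | nil => rfl
  | cons hadj _ =>
    obtain ⟨-, j, hj, hvj, -⟩ := hadj
    exact (hv j hj hvj).elim

end PrimalGraph

section HypertreeFamilies

variable {V ι κ : Type*} {e : ι → Finset V} {i j : ι} {r v x y : V}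

/-- The edges `e j` are those of a hypertree with vertex set `V`. Acyclicity is expressed by the
condition that the vertices of an edge lie in different connected components as soon as this edge is
removed; the advantage over `MultiHypergraph` is that the edges are labelled by `ι`. -/
structure IsHypertreeFamily (e : ι → Finset V) : Prop where
  two_le_card : ∀ j, 2 ≤ (e j).card
  preconnected : (primalGraph e Set.univ).Preconnected
  eq_of_reachable : ∀ ⦃j x y⦄, x ∈ e j → y ∈ e j → (primalGraph e {j}ᶜ).Reachable x y → x = y

namespace IsHypertreeFamily

theorem comp_equiv (h : IsHypertreeFamily e) (φ : κ ≃ ι) : IsHypertreeFamily (e ∘ φ) where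
  two_le_card j := h.two_le_card (φ j)
  preconnected := by simpa [primalGraph_comp_equiv] using h.preconnected
  eq_of_reachable j x y hx hy hxy := h.eq_of_reachable hx hy <| by
    simpa [primalGraph_comp_equiv, Set.image_compl_eq φ.bijective] using hxy

theorem injective (h : IsHypertreeFamily e) : Function.Injective e := by
  intro i j hij
  by_contra hne
  obtain ⟨x, hx, y, hy, hxy⟩ := Finset.one_lt_card.1 (h.two_le_card i)
  exact hxy <| h.eq_of_reachable hx hy <|
    reachable_primalGraph_of_mem (Ne.symm hne) (hij ▸ hx) (hij ▸ hy)

theorem exists_mem_reachable (h : IsHypertreeFamily e) (j : ι) (r : V) :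
    ∃ x ∈ e j, (primalGraph e {j}ᶜ).Reachable x r := by
  obtain ⟨x, hx⟩ : (e j).Nonempty := Finset.card_pos.1 (zero_lt_two.trans_le (h.two_le_card j))
  have hsplit := reachable_sdiff_or_exists_mem (h.preconnected x r) {j}
  rw [← Set.compl_eq_univ_sdiff] at hsplit
  obtain hxr | ⟨_, rfl, hz⟩ := hsplit
  · exact ⟨x, hx, hxr⟩
  · exact hz

theorem exists_mem_not_reachable (h : IsHypertreeFamily e) (hv : v ≠ r) :
    ∃ j, v ∈ e j ∧ ¬ (primalGraph e {j}ᶜ).Reachable v r := by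
  have hsplit := reachable_sdiff_or_exists_mem (h.preconnected v r) {j | v ∈ e j}
  rw [← Set.compl_eq_univ_sdiff] at hsplit
  have hisolated : ¬ (primalGraph e {j | v ∈ e j}ᶜ).Reachable v r := fun hreach =>
    hv (eq_of_reachable_of_forall_notMem (fun _ hj => hj) hreach)
  obtain ⟨j, hvj, x, hx, hxr⟩ := hsplit.resolve_left hisolated
  refine ⟨j, hvj, fun hvr => hisolated ?_⟩
  have hxr' : (primalGraph e {j}ᶜ).Reachable x r :=
    hxr.mono (primalGraph_mono (Set.compl_subset_compl.2 (Set.singleton_subset_iff.2 hvj)))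
  have hvx : v = x := h.eq_of_reachable hvj hx (hvr.trans hxr'.symm)
  exact hvx ▸ hxr

theorem eq_of_not_reachable (h : IsHypertreeFamily e) (hvi : v ∈ e i) (hvj : v ∈ e j)
    (hi : ¬ (primalGraph e {i}ᶜ).Reachable v r) (hj : ¬ (primalGraph e {j}ᶜ).Reachable v r) :
    i = j := by
  by_contra hne
  obtain ⟨x, hx, hxr⟩ := h.exists_mem_reachable i r
  obtain hxr' | ⟨_, rfl, z, hz, hzr⟩ := reachable_sdiff_or_exists_mem hxr {j}
  · exact hj <| (reachable_primalGraph_of_mem hne hvi hx).trans <|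
      hxr'.mono (primalGraph_mono fun _ hk => hk.2)
  · exact hi <| (reachable_primalGraph_of_mem (Ne.symm hne) hvj hz).trans <|
      hzr.mono (primalGraph_mono Set.sdiff_subset)

end IsHypertreeFamily

/-- The edges whose removal separates `v` from `r`. -/
def separatingEdges (e : ι → Finset V) (r v : V) : Set ι :=
  {j | ¬ (primalGraph e {j}ᶜ).Reachable v r}

theorem separatingEdges_ssubset (hv : v ∈ e j) (hx : x ∈ e j)
    (hvr : ¬ (primalGraph e {j}ᶜ).Reachable v r) (hxr : (primalGraph e {j}ᶜ).Reachable x r) :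
    separatingEdges e r x ⊂ separatingEdges e r v := by
  refine (Set.ssubset_iff_of_subset fun i hi hvi => ?_).2 ⟨j, hvr, not_not.2 hxr⟩
  have hij : j ≠ i := by
    rintro rfl
    exact hi hxr
  exact hi ((reachable_primalGraph_of_mem hij hx hv).trans hvi)

end HypertreeFamilies

section Rootings

variable {V ι : Type*} {e : ι → Finset V} {r v x y : V} {f : V → Option ι} {p : ι → V} {i j : ι}

/-- A surjective labelling of the vertices other than the root `r`, with `none` as label of `r`. -/
structure IsRootedLabelling (r : V) (f : V → Option ι) : Prop where
  eq_none_iff : ∀ v, f v = none ↔ v = r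
  exists_eq_some : ∀ j, ∃ v, f v = some j

/-- The description of a family `e` of edges relative to a root `r`: the edge `e j` consists of its
parent `p j`, which is its vertex closest to the root, and of the vertices labelled `j` by `f`,
which are those joined to the root through `e j`. -/
structure IsRooting (e : ι → Finset V) (r : V) (f : V → Option ι) (p : ι → V) : Prop extends
    IsRootedLabelling r f where
  mem_iff : ∀ j v, v ∈ e j ↔ v = p j ∨ f v = some j
  acyclic : IsAcyclicParent f p

theorem IsHypertreeFamily.exists_isRooting [Finite ι] (h : IsHypertreeFamily e) (r : V) :
    ∃ f p, IsRooting e r f p := by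
  choose p hp_mem hp_reach using fun j => h.exists_mem_reachable j r
  have hlabel (v : V) : ∃ o : Option ι, ∀ j, o = some j ↔
      v ∈ e j ∧ ¬ (primalGraph e {j}ᶜ).Reachable v r := by
    by_cases hv : v = r
    · exact ⟨none, fun j => by simp [hv]⟩
    · obtain ⟨i, hi_mem, hi⟩ := h.exists_mem_not_reachable hv
      refine ⟨some i, fun j => ⟨?_, fun hj => ?_⟩⟩
      · rintro ⟨⟩
        exact ⟨hi_mem, hi⟩
      · rw [h.eq_of_not_reachable hi_mem hj.1 hi hj.2]
  choose f hf using hlabel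
  refine ⟨f, p, ⟨fun v => ⟨fun hv => ?_, ?_⟩, fun j => ?_⟩, fun j v => ⟨fun hv => ?_, ?_⟩, ?_⟩
  · by_contra hne
    obtain ⟨j, hj⟩ := h.exists_mem_not_reachable hne
    simp [(hf v j).2 hj] at hv
  · rintro rfl
    exact Option.eq_none_iff_forall_ne_some.2 fun j hj => ((hf v j).1 hj).2 .rfl
  · obtain ⟨v, hv, hne⟩ := Finset.exists_mem_ne (h.two_le_card j) (p j)
    exact ⟨v, (hf v j).2 ⟨hv, fun hvr =>
      hne (h.eq_of_reachable hv (hp_mem j) (hvr.trans (hp_reach j).symm))⟩⟩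
  · by_cases hvr : (primalGraph e {j}ᶜ).Reachable v r
    · exact .inl (h.eq_of_reachable hv (hp_mem j) (hvr.trans (hp_reach j).symm))
    · exact .inr ((hf v j).2 ⟨hv, hvr⟩)
  · rintro (rfl | hv)
    exacts [hp_mem j, ((hf v j).1 hv).1]
  · refine ⟨fun i => (separatingEdges e r (p i)).ncard, fun i j hij => ?_⟩
    obtain ⟨hmem, hreach⟩ := (hf _ _).1 hij
    exact Set.ncard_lt_ncard (separatingEdges_ssubset hmem (hp_mem j) hreach (hp_reach j))

namespace IsRooting

theorem parent_mem (h : IsRooting e r f p) (j : ι) : p j ∈ e j :=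
  (h.mem_iff _ _).2 (.inl rfl)

theorem mem_of_eq_some (h : IsRooting e r f p) (hv : f v = some j) : v ∈ e j :=
  (h.mem_iff _ _).2 (.inr hv)

theorem eq_some_iff (h : IsRooting e r f p) : f v = some j ↔ v ∈ e j ∧ v ≠ p j := by
  have hparent : f (p j) ≠ some j := fun hj => h.acyclic.elim fun _ hrank => (hrank _ _ hj).false
  refine ⟨fun hv => ⟨h.mem_of_eq_some hv, ?_⟩, fun hv => ((h.mem_iff _ _).1 hv.1).resolve_left hv.2⟩
  rintro rfl
  exact hparent hv

theorem two_le_card (h : IsRooting e r f p) (j : ι) : 2 ≤ (e j).card := by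
  obtain ⟨v, hv⟩ := h.exists_eq_some j
  obtain ⟨hv_mem, hne⟩ := h.eq_some_iff.1 hv
  exact Finset.one_lt_card.2 ⟨v, hv_mem, p j, h.parent_mem j, hne⟩

theorem reachable_parent (h : IsRooting e r f p) (j : ι) :
    (primalGraph e {j}ᶜ).Reachable (p j) r := by
  obtain ⟨rank, hrank⟩ := h.acyclic
  suffices hle : ∀ i, rank i ≤ rank j → (primalGraph e {j}ᶜ).Reachable (p i) r from hle j le_rfl
  intro i hi
  induction hn : rank i using Nat.strong_induction_on generalizing i with
  | _ n ih =>
    rcases hlabel : f (p i) with _ | k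
    · rw [(h.eq_none_iff _).1 hlabel]
    · have hk : rank k < rank i := hrank _ _ hlabel
      have hkj : k ≠ j := by
        rintro rfl
        exact hk.not_ge hi
      exact (reachable_primalGraph_of_mem hkj (h.mem_of_eq_some hlabel) (h.parent_mem k)).trans
        (ih _ (hn ▸ hk) k (hk.le.trans hi) rfl)

theorem preconnected (h : IsRooting e r f p) : (primalGraph e Set.univ).Preconnected := by
  have hroot (v : V) : (primalGraph e Set.univ).Reachable v r := by
    rcases hv : f v with _ | j
    · rw [(h.eq_none_iff _).1 hv]
    · exact (reachable_primalGraph_of_mem (Set.mem_univ j) (h.mem_of_eq_some hv)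
        (h.parent_mem j)).trans ((h.reachable_parent j).mono (primalGraph_mono (Set.subset_univ _)))
  exact fun x y => (hroot x).trans (hroot y).symm

end IsRooting

/-- The relation between a vertex `x` with label `j` and its parent `p j`. -/
def ParentStep (f : V → Option ι) (p : ι → V) (x y : V) : Prop :=
  ∃ j, f x = some j ∧ p j = y

theorem IsAcyclicParent.not_transGen_parentStep (h : IsAcyclicParent f p) (x : V) :
    ¬ Relation.TransGen (ParentStep f p) x x := by
  obtain ⟨rank, hrank⟩ := h
  let depth (v : V) : ℕ := (f v).elim 0 fun j => rank j + 1
  have hdepth (x y : V) (hxy : ParentStep f p x y) : depth y < depth x := by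
    obtain ⟨j, hx, rfl⟩ := hxy
    rcases hy : f (p j) with _ | k
    · simp [depth, hx, hy]
    · simpa [depth, hx, hy] using hrank _ _ hy
  intro hloop
  exact lt_irrefl _ <| Relation.transGen_eq_self (r := fun a b : ℕ => b < a) ▸
    hloop.lift depth hdepth

namespace IsRooting

theorem reflTransGen_of_reachable (h : IsRooting e r f p) (hx : f x = some j)
    (hxy : (primalGraph e {j}ᶜ).Reachable x y) : Relation.ReflTransGen (ParentStep f p) y x := by
  rw [SimpleGraph.reachable_iff_reflTransGen] at hxy
  induction hxy with
  | refl => rfl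
  | @tail u w _ hadj ih =>
    obtain ⟨-, i, hij, hu, hw⟩ := hadj
    -- If an edge other than `j` contains a descendant of `x`, then its parent is a descendant too.
    have hpx : Relation.ReflTransGen (ParentStep f p) (p i) x := by
      obtain rfl | hui := (h.mem_iff _ _).1 hu
      · exact ih
      · obtain rfl | ⟨_, ⟨k, huk, rfl⟩, hkx⟩ := ih.cases_head
        · exact (hij (Option.some_injective _ (hui.symm.trans hx))).elim
        · rwa [Option.some_injective _ (hui.symm.trans huk)]
    obtain rfl | hwi := (h.mem_iff _ _).1 hw
    exacts [hpx, hpx.head ⟨i, hwi, rfl⟩]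

theorem eq_of_reachable (h : IsRooting e r f p) (hx : x ∈ e j) (hy : y ∈ e j)
    (hxy : (primalGraph e {j}ᶜ).Reachable x y) : x = y := by
  by_contra hne
  wlog hxj : f x = some j generalizing x y
  · have hyj : f y = some j := by
      have hxp : x = p j := ((h.mem_iff _ _).1 hx).resolve_right hxj
      exact h.eq_some_iff.2 ⟨hy, fun hyp => hne (hxp.trans hyp.symm)⟩
    exact this hy hx hxy.symm (Ne.symm hne) hyj
  have hpx : Relation.ReflTransGen (ParentStep f p) (p j) x := by
    have hyx := h.reflTransGen_of_reachable hxj hxy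
    obtain rfl | hyj := (h.mem_iff _ _).1 hy
    · exact hyx
    · obtain rfl | ⟨z, ⟨k, hyk, rfl⟩, hkx⟩ := hyx.cases_head
      · exact (hne rfl).elim
      · rwa [Option.some_injective _ (hyj.symm.trans hyk)]
  exact h.acyclic.not_transGen_parentStep x (.head' ⟨j, hxj, rfl⟩ hpx)

theorem isHypertreeFamily (h : IsRooting e r f p) : IsHypertreeFamily e where
  two_le_card := h.two_le_card
  preconnected := h.preconnected
  eq_of_reachable _ _ _ := h.eq_of_reachable

theorem unique {f' : V → Option ι} {p' : ι → V} (h : IsRooting e r f p)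
    (h' : IsRooting e r f' p') : f = f' ∧ p = p' := by
  have hp : p = p' := funext fun j => h.eq_of_reachable (h.parent_mem j) (h'.parent_mem j)
    ((h.reachable_parent j).trans (h'.reachable_parent j).symm)
  subst hp
  exact ⟨funext fun v => Option.ext fun j => h.eq_some_iff.trans h'.eq_some_iff.symm, rfl⟩

end IsRooting

end Rootings

section Walks

theorem dist_getVert_of_length_eq_dist {V : Type*} {G : SimpleGraph V} {x y : V} {p : G.Walk x y}
    (hp : p.length = G.dist x y) {i j : ℕ} (hij : i ≤ j) (hj : j ≤ p.length) :
    G.dist (p.getVert i) (p.getVert j) = j - i := by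
  have hsub := SimpleGraph.length_eq_dist_of_subwalk hp
    (((p.drop i).isSubwalk_take (j - i)).trans (p.isSubwalk_drop i))
  have hend : (p.drop i).getVert (j - i) = p.getVert j := by
    rw [SimpleGraph.Walk.drop_getVert, Nat.add_sub_cancel' hij]
  rw [← hend, ← hsub, SimpleGraph.Walk.take_length, SimpleGraph.Walk.drop_length]
  lia

namespace MultiHypergraph

theorem edges_injective {V : Type*} : Function.Injective (edges (V := V)) := by
  rintro ⟨_, _⟩ ⟨_, _⟩ rfl
  rfl

variable {V : Type*} [DecidableEq V] {H : MultiHypergraph V} {S : Set H.Edge} {x y : V}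

/-- The edges of `H`, as a family indexed by the type that tells copies of an edge apart. -/
abbrev edgeFamily (H : MultiHypergraph V) (j : H.Edge) : Finset V := j.1

namespace Walk

theorem reachable_vert (w : H.Walk) {i : Fin (w.length + 1)}
    (hS : ∀ k : Fin w.length, k.castSucc < i → w.edge k ∈ S) :
    (primalGraph H.edgeFamily S).Reachable (w.vert 0) (w.vert i) := by
  induction i using Fin.induction with
  | zero => rfl
  | succ i ih =>
    exact (ih fun k hk => hS k (hk.trans i.castSucc_lt_succ)).trans <|
      reachable_primalGraph_of_mem (hS i i.castSucc_lt_succ) (w.left_mem i) (w.right_mem i)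

/-- Appends to a walk a last edge leading back to the first vertex. -/
def close (w : H.Walk) (j : H.Edge) (hfirst : w.vert 0 ∈ j.1)
    (hlast : w.vert (Fin.last w.length) ∈ j.1) : H.Walk where
  length := w.length + 1
  vert := Fin.snoc w.vert (w.vert 0)
  edge := Fin.snoc w.edge j
  left_mem := Fin.lastCases (by simpa using hlast) fun i => by simpa using w.left_mem i
  right_mem := Fin.lastCases (by simpa using hfirst) fun i => by
    simpa only [Fin.succ_castSucc, Fin.snoc_castSucc] using w.right_mem i

theorem IsPath.isCycle_close {w : H.Walk} (hw : w.IsPath) {j : H.Edge}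
    (hne : w.vert 0 ≠ w.vert (Fin.last w.length)) (hj : j ∉ Set.range w.edge)
    (hfirst : w.vert 0 ∈ j.1) (hlast : w.vert (Fin.last w.length) ∈ j.1) :
    (w.close j hfirst hlast).IsCycle := by
  refine ⟨?_, Fin.snoc_injective_iff.2 ⟨hw.2, hj⟩, ?_, ?_⟩
  · have hlength : w.length ≠ 0 := fun h0 => hne <| congrArg w.vert <| Fin.ext <| by simp [h0]
    simp only [close]
    lia
  · simp only [close, Fin.snoc_last]
    exact Fin.snoc_castSucc (α := fun _ => V) (w.vert 0) w.vert 0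
  · simpa [close] using hw.1

theorem IsCycle.exists_reachable {w : H.Walk} (hw : w.IsCycle) :
    ∃ (j : H.Edge) (x y : V), x ≠ y ∧ x ∈ j.1 ∧ y ∈ j.1 ∧
      (primalGraph H.edgeFamily {j}ᶜ).Reachable x y := by
  obtain ⟨hlength, hedge, hclosed, hvert⟩ := hw
  let l : Fin w.length := ⟨w.length - 1, by lia⟩
  let z : Fin w.length := ⟨0, by lia⟩
  have hl : l.succ = Fin.last w.length := Fin.ext (by simp [l]; lia)
  refine ⟨w.edge l, w.vert 0, w.vert l.castSucc, fun h => ?_, ?_, w.left_mem l,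
    w.reachable_vert fun k hk => ?_⟩
  · have hzl : z = l := hvert h
    simp only [z, l, Fin.mk.injEq] at hzl
    lia
  · rw [hclosed, ← hl]
    exact w.right_mem l
  · exact hedge.ne (Fin.castSucc_lt_castSucc_iff.1 hk).ne

end Walk

theorem exists_isPath_of_reachable (h : (primalGraph H.edgeFamily S).Reachable x y) :
    ∃ w : H.Walk, w.IsPath ∧ w.vert 0 = x ∧ w.vert (Fin.last w.length) = y ∧
      ∀ i, w.edge i ∈ S := by
  obtain ⟨p, hp⟩ := h.exists_walk_length_eq_dist
  have hadj (i : Fin p.length) := (p.adj_getVert_succ i.2).2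
  choose edge hedge hleft hright using hadj
  have hedge_inj : Function.Injective edge := by
    -- A repeated edge would be a shortcut of the shortest path `p`.
    refine .of_lt_imp_ne fun i j hij heq => ?_
    have hdist := dist_getVert_of_length_eq_dist hp (i := i) (j := j + 1) (by lia) (by lia)
    have hne : p.getVert i ≠ p.getVert (j + 1) := fun hv => by
      rw [hv, SimpleGraph.dist_self] at hdist
      lia
    have hshort : (primalGraph H.edgeFamily S).Adj (p.getVert i) (p.getVert (j + 1)) :=
      ⟨hne, edge i, hedge i, hleft i, heq ▸ hright j⟩
    rw [SimpleGraph.dist_eq_one_iff_adj.2 hshort] at hdist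
    lia
  refine ⟨⟨p.length, fun i => p.getVert i, edge, hleft, hright⟩, ⟨fun i j hij => ?_, hedge_inj⟩,
    by simp, by simp, hedge⟩
  exact Fin.ext ((p.isPath_of_length_eq_dist hp).getVert_injOn (Nat.lt_succ_iff.1 i.2)
    (Nat.lt_succ_iff.1 j.2) hij)

theorem isHypertree_iff_isHypertreeFamily_edgeFamily :
    H.IsHypertree ↔ IsHypertreeFamily H.edgeFamily := by
  constructor
  · rintro ⟨hconn, hacyclic⟩
    refine ⟨fun j => H.two_le_card _ (Multiset.coe_mem), fun x y => ?_, fun j x y hx hy hxy => ?_⟩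
    · obtain ⟨w, -, rfl, rfl⟩ := hconn x y
      exact w.reachable_vert fun _ _ => Set.mem_univ _
    · by_contra hne
      obtain ⟨w, hw, rfl, rfl, hedge⟩ := exists_isPath_of_reachable hxy
      refine hacyclic _ (hw.isCycle_close hne ?_ hx hy)
      rintro ⟨i, hi⟩
      exact hedge i hi
  · refine fun h => ⟨fun x y => ?_, fun w hw => ?_⟩
    · obtain ⟨w, hw, hx, hy, -⟩ := exists_isPath_of_reachable (h.preconnected x y)
      exact ⟨w, hw, hx, hy⟩
    · obtain ⟨j, x, y, hne, hx, hy, hxy⟩ := hw.exists_reachable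
      exact hne (h.eq_of_reachable hx hy hxy)

theorem isHypertree_iff {ι : Type*} [Fintype ι] {e : ι → Finset V}
    (he : Finset.univ.val.map e = H.edges) : H.IsHypertree ↔ IsHypertreeFamily e := by
  obtain ⟨φ, hφ⟩ := exists_equiv_toType_of_map_univ_eq he
  have hcomp : H.edgeFamily ∘ φ = e := funext hφ
  rw [isHypertree_iff_isHypertreeFamily_edgeFamily, ← hcomp]
  refine ⟨fun h => h.comp_equiv φ, fun h => ?_⟩
  simpa [Function.comp_assoc] using h.comp_equiv φ.symm

end MultiHypergraph

end Walks

section Count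

variable {V : Type*} (ι : Type*)

/-- A rooted labelling is a surjection from the complement of the root. -/
def rootedLabellingEquiv [DecidableEq V] (r : V) :
    {f : V → Option ι // IsRootedLabelling r f} ≃
      {g : {v // v ≠ r} → ι // Function.Surjective g} where
  toFun f := ⟨fun v => (f.1 v).get (Option.isSome_iff_ne_none.2 (mt (f.2.eq_none_iff v).1 v.2)),
    fun j => by
      obtain ⟨v, hv⟩ := f.2.exists_eq_some j
      refine ⟨⟨v, fun hvr => ?_⟩, by simp [hv]⟩
      simp [(f.2.eq_none_iff v).2 hvr] at hv⟩
  invFun g := ⟨fun v => if h : v = r then none else some (g.1 ⟨v, h⟩), fun v => by simp, fun j => by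
    obtain ⟨v, rfl⟩ := g.2 j
    exact ⟨v, by simp [v.2]⟩⟩
  left_inv f := Subtype.ext <| funext fun v => by
    by_cases hv : v = r
    · simp [hv, (f.2.eq_none_iff r).2 rfl]
    · simp [hv]
  right_inv g := Subtype.ext <| funext fun v => by simp [v.2]

theorem card_isRootedLabelling [Finite V] [Finite ι] (r : V) :
    Nat.card {f : V → Option ι // IsRootedLabelling r f} =
      (Nat.card ι).factorial * (Nat.card V - 1).stirlingSecond (Nat.card ι) := by
  classical
  have : Fintype V := Fintype.ofFinite V
  have hcompl : Nat.card {v // v ≠ r} = Nat.card V - 1 := by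
    simp [Fintype.card_subtype_compl]
  rw [Nat.card_congr (rootedLabellingEquiv ι r), card_surjective, hcompl]

theorem card_sigma_isRootedLabelling_mul_card [Finite V] [Finite ι] (r : V) :
    Nat.card (Σ f : {f : V → Option ι // IsRootedLabelling r f},
        {p : ι → V // IsAcyclicParent f.1 p}) * Nat.card V =
      (Nat.card ι).factorial *
        (Nat.card V ^ Nat.card ι * (Nat.card V - 1).stirlingSecond (Nat.card ι)) := by
  have : Fintype {f : V → Option ι // IsRootedLabelling r f} := Fintype.ofFinite _
  have hparents (f : {f : V → Option ι // IsRootedLabelling r f}) :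
      Nat.card {p : ι → V // IsAcyclicParent f.1 p} * Nat.card V = Nat.card V ^ Nat.card ι := by
    simp [card_isAcyclicParent_mul_card, f.2.eq_none_iff]
  rw [Nat.card_sigma, Finset.sum_mul, Finset.sum_congr rfl fun f _ => hparents f, Finset.sum_const,
    Finset.card_univ, ← Nat.card_eq_fintype_card, card_isRootedLabelling, smul_eq_mul]
  ring

theorem card_isHypertreeFamily_mul_card [Finite V] [Nonempty V] [Finite ι] :
    Nat.card {e : ι → Finset V // IsHypertreeFamily e} * Nat.card V =
      (Nat.card ι).factorial *
        (Nat.card V ^ Nat.card ι * (Nat.card V - 1).stirlingSecond (Nat.card ι)) := by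
  classical
  have : Fintype V := Fintype.ofFinite V
  obtain ⟨r⟩ := ‹Nonempty V›
  rw [← card_sigma_isRootedLabelling_mul_card ι r]
  let edges (x : Σ f : {f : V → Option ι // IsRootedLabelling r f},
      {p : ι → V // IsAcyclicParent f.1 p}) (j : ι) : Finset V :=
    insert (x.2.1 j) (Finset.univ.filter fun v => x.1.1 v = some j)
  have hedges (x) : IsRooting (edges x) r x.1.1 x.2.1 :=
    ⟨x.1.2, fun j v => by simp [edges], x.2.2⟩
  congr 1
  symm
  refine Nat.card_eq_of_bijective (fun x => ⟨edges x, (hedges x).isHypertreeFamily⟩) ⟨?_, ?_⟩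
  · intro x y hxy
    have hx := hedges x
    rw [Subtype.mk.inj hxy] at hx
    obtain ⟨hf, hp⟩ := hx.unique (hedges y)
    clear hx hxy
    obtain ⟨⟨f, _⟩, ⟨p, _⟩⟩ := x
    obtain ⟨⟨f', _⟩, ⟨p', _⟩⟩ := y
    obtain ⟨rfl, rfl⟩ : f = f' ∧ p = p' := ⟨hf, hp⟩
    rfl
  · rintro ⟨e, he⟩
    obtain ⟨f, p, h⟩ := he.exists_isRooting r
    refine ⟨⟨⟨f, h.toIsRootedLabelling⟩, p, h.acyclic⟩, Subtype.ext <| funext fun j => ?_⟩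
    ext v
    simp [edges, h.mem_iff]

end Count

section HypertreeCount

variable (V : Type*) [DecidableEq V]

theorem encard_isHypertreeFamily_eq_factorial_mul (k : ℕ) :
    {e : Fin k → Finset V | IsHypertreeFamily e}.encard =
      k.factorial * {H : MultiHypergraph V | H.IsHypertree ∧ H.edges.card = k}.encard := by
  have hfamily : {e : Fin k → Finset V | IsHypertreeFamily e} = {e | Finset.univ.val.map e ∈
      MultiHypergraph.edges '' {H : MultiHypergraph V | H.IsHypertree ∧ H.edges.card = k}} := by
    ext e
    constructor
    · intro he
      let H : MultiHypergraph V := ⟨Finset.univ.val.map e, by simpa using he.two_le_card⟩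
      exact ⟨H, ⟨(MultiHypergraph.isHypertree_iff rfl).2 he, by simp [H]⟩, rfl⟩
    · rintro ⟨H, ⟨hH, -⟩, hedges⟩
      exact (MultiHypergraph.isHypertree_iff hedges.symm).1 hH
  rw [hfamily, encard_setOf_map_univ_mem, Fintype.card_fin,
    MultiHypergraph.edges_injective.encard_image]
  · rintro _ ⟨H, ⟨hH, hcard⟩, rfl⟩
    obtain ⟨e, he⟩ := exists_map_univ_eq (ι := Fin k) (by rw [hcard, Fintype.card_fin])
    have hinj := ((MultiHypergraph.isHypertree_iff he).1 hH).injective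
    exact he ▸ Finset.univ.nodup.map hinj
  · rintro _ ⟨H, ⟨-, hcard⟩, rfl⟩
    rw [hcard, Fintype.card_fin]

variable [Finite V] [Nonempty V]

theorem encard_rootedHypertrees_card_eq (k : ℕ) :
    {p ∈ rootedHypertrees V | p.1.edges.card = k}.encard =
      ((Nat.card V ^ k * (Nat.card V - 1).stirlingSecond k : ℕ) : ℕ∞) := by
  have hprod : {p ∈ rootedHypertrees V | p.1.edges.card = k} =
      {H : MultiHypergraph V | H.IsHypertree ∧ H.edges.card = k} ×ˢ Set.univ := by
    ext p
    simp [rootedHypertrees]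
  have hcount := card_isHypertreeFamily_mul_card (V := V) (Fin k)
  have hcast : ({e : Fin k → Finset V | IsHypertreeFamily e}.encard * Nat.card V : ℕ∞) =
      k.factorial * (Nat.card V ^ k * (Nat.card V - 1).stirlingSecond k : ℕ) := by
    rw [Nat.card_fin] at hcount
    rw [← (Set.toFinite _).cast_ncard_eq]
    exact_mod_cast hcount
  rw [encard_isHypertreeFamily_eq_factorial_mul, mul_assoc] at hcast
  have hfactorial : (k.factorial : ℕ∞) ≠ 0 := by exact_mod_cast k.factorial_ne_zero
  rw [hprod, Set.encard_prod, Set.encard_univ, ENat.card_eq_coe_natCard]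
  exact (ENat.mul_right_strictMono hfactorial (ENat.natCast_ne_top _)).injective hcast

theorem card_edges_lt_of_mem_rootedHypertrees {p : MultiHypergraph V × V}
    (hp : p ∈ rootedHypertrees V) : p.1.edges.card < Nat.card V := by
  by_contra! hle
  have hzero : {q ∈ rootedHypertrees V | q.1.edges.card = p.1.edges.card}.encard = 0 := by
    have hpos : 0 < Nat.card V := Nat.card_pos
    rw [encard_rootedHypertrees_card_eq, Nat.stirlingSecond_eq_zero_of_lt (by lia), mul_zero,
      Nat.cast_zero]
  exact (Set.encard_eq_zero.1 hzero).subset ⟨hp, rfl⟩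

theorem mainTheorem8_general :
    (∀ k : ℕ, {p ∈ rootedHypertrees V | p.1.edges.card = k}.encard =
      ((Nat.card V ^ k * (Nat.card V - 1).stirlingSecond k : ℕ) : ℕ∞)) ∧
    (rootedHypertrees V).encard =
      ((∑ k ∈ Finset.range (Nat.card V),
        Nat.card V ^ k * (Nat.card V - 1).stirlingSecond k : ℕ) : ℕ∞) := by
  refine ⟨encard_rootedHypertrees_card_eq V, ?_⟩
  rw [encard_eq_sum_encard_fiber fun p hp =>
    Finset.mem_range.2 (card_edges_lt_of_mem_rootedHypertrees V hp), Nat.cast_sum]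
  exact Finset.sum_congr rfl fun k _ => encard_rootedHypertrees_card_eq V k

end HypertreeCount

theorem mainTheorem8 (n : ℕ) (hn : 1 ≤ n) :
    (∀ k : ℕ, Set.encard {p ∈ rootedHypertrees (Fin n) | p.1.edges.card = k} =
      ((n ^ k * Nat.stirlingSecond (n - 1) k : ℕ) : ℕ∞)) ∧
    Set.encard (rootedHypertrees (Fin n)) =
      ((∑ k ∈ Finset.range n, n ^ k * Nat.stirlingSecond (n - 1) k : ℕ) : ℕ∞) := by
  have : Nonempty (Fin n) := ⟨⟨0, hn⟩⟩
  simpa only [Nat.card_fin] using mainTheorem8_general (Fin n)
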